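/- Consider $N$-player games in which each player $i$ chooses a vector from a nonempty set and minimizes a real-valued cost that depends on the choices of all players. Let the large-scale game $\mathcal G^B$ have decision sets $X^i\subseteq\mathbb R^M$ and costs $J^i:X^1\times\dots\times X^N\to\mathbb R$. Suppose that each $X^i$ is closed, bounded and convex, and that each $J^i$ is jointly continuous in all its arguments and strictly convex in $x^i$ for every $x^{-i}$. Let $A^i\in\mathbb R^{K\times M}$, $i=1,\dots,N$, and let the reduced game $\mathcal G^T$ be obtained from $\mathcal G^B$ through the linear maps $y^i=A^ix^i$. That is, its decision sets are $Y^i=A^iX^i\subseteq\mathbb R^K$, and its costs $\tilde J^i:Y^1\times\dots\times Y^N\to\mathbb R$ are those of $\mathcal G^B$ in the reduced variables, $$\tilde J^i(A^1x^1,\dots,A^Nx^N)=J^i(x^1,\dots,x^N)\qquad\text{for all } i \text{ and all } x\in R^1\times\dots\times R^N,$$ where $R^j\subseteq X^j$ are convex sets with $A^jR^j=Y^j$ (for instance $R^j=X^j$, or the range of an affine right inverse $Y^j\to X^j$ of $A^j$). Then $\mathcal G^T$ admits a pure Nash equilibrium: there is $y\in Y^1\times\dots\times Y^N$ such that $\tilde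 J^i(y^i,y^{-i})\le\tilde J^i(z,y^{-i})$ for every player $i$ and every $z\in Y^i$. -/

import Mathlib

/-- A static game with players `Fin N` and continuous decision variables: player `i` has the
nonempty decision set `X i ⊆ ℝ^d` and the real-valued cost `J i` on decision profiles.  Only the
values of the costs on profiles of admissible decisions are ever used. -/
structure StrategicGame (N d : ℕ) where
  /-- the decision sets -/
  X : Fin N → Set (Fin d → ℝ)
  /-- every player has a decision to choose from -/
  X_nonempty : ∀ i, (X i).Nonempty
  /-- the costs, which the players minimize -/
  J : Fin N → (Fin N → Fin d → ℝ) → ℝ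

namespace StrategicGame

variable {N d M K : ℕ}

/-- The joint decision space, the product of the decision sets. -/
def profiles (G : StrategicGame N d) : Set (Fin N → Fin d → ℝ) :=
  Set.univ.pi G.X

/-- A pure Nash equilibrium: an admissible profile in which every player's decision minimizes
her own cost over her decision set, given the decisions of the others. -/
def IsNashEquilibrium (G : StrategicGame N d) (x : Fin N → Fin d → ℝ) : Prop :=
  x ∈ G.profiles ∧ ∀ i, ∀ z ∈ G.X i, G.J i x ≤ G.J i (Function.update x i z)

/-- Every decision set is closed, bounded and convex, and every cost is jointly continuous on the
joint decision space and strictly convex in the player's own variable, for any decisions of the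
others. -/
structure IsContinuousStrictlyConvex (G : StrategicGame N d) : Prop where
  isClosed : ∀ i, IsClosed (G.X i)
  isBounded : ∀ i, Bornology.IsBounded (G.X i)
  convex : ∀ i, Convex ℝ (G.X i)
  continuousOn : ∀ i, ContinuousOn (G.J i) G.profiles
  strictConvexOn : ∀ i, ∀ x ∈ G.profiles,
    StrictConvexOn ℝ (G.X i) (fun z => G.J i (Function.update x i z))

/-- `GT` is a reduced game of `GB` through the per-player linear maps `y i = A i *ᵥ x i`:
its decision sets are the images of those of `GB`, and its costs are those of `GB` expressed in
the reduced variables, `GT.J i (A x) = GB.J i x`.  The last identity is required for the profiles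
`x` with `x j ∈ R j`, where `R j ⊆ GB.X j` is some convex set of decisions that represents every
reduced decision.  `R = GB.X` is the case in which it holds for all profiles of `GB`; when `A j`
is not injective on `GB.X j`, smaller sets are possible, such as the range of an affine right
inverse of `A j`. -/
def IsReduction (GB : StrategicGame N M) (A : Fin N → Matrix (Fin K) (Fin M) ℝ)
    (GT : StrategicGame N K) : Prop :=
  (∀ i, GT.X i = (fun v => (A i).mulVec v) '' GB.X i) ∧
  ∃ R : Fin N → Set (Fin M → ℝ),
    (∀ i, R i ⊆ GB.X i ∧ Convex ℝ (R i) ∧ (fun v => (A i).mulVec v) '' R i = GT.X i) ∧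
    ∀ x ∈ Set.univ.pi R, ∀ i, GT.J i (fun j => (A j).mulVec (x j)) = GB.J i x

end StrategicGame

/-!
Strict convexity forces each `A i` to be injective on the convex set `R i` of representatives:
if two of them had the same image, the cost of player `i` would be constant on their segment
(`StrategicGame.IsContinuousStrictlyConvex.injOn_mulVec`). Hence `A i` is injective on the span of
the differences of `R i`, and as it maps `R i` onto the compact set `A i (X i)`, `R i` is closed
(`Convex.isClosed_of_injOn`). So the large game restricted to the compact convex sets `R i` has
continuous costs, convex in the player's own variable. It has an equilibrium, which `A` carries
to an equilibrium of the reduced game.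

The existence of the equilibrium (`exists_equilibrium_of_convexOn`) is as deep as Brouwer's fixed
point theorem, of which no form is in Mathlib. It follows from Ky Fan's inequality
(`exists_forall_le_zero`), applied to `∑ i, (J i x - J i (x with z i in place of x i))`. Ky Fan's
inequality reduces, by compactness and a map in the manner of Nash, to a statement on closed
coverings of a simplex (`exists_mem_stdSimplex_forall_mem`). That one is the limit of the
combinatorial lemma of Scarf (`exists_isDominating_image_eq_univ`) on finer and finer grids. Scarf's
lemma plays the role of Sperner's, with families of linear rankings in place of triangulations, and
is proved by the same parity count.
-/

/-! ### A combinatorial lemma of Scarf -/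

section Scarf

variable {I P : Type*} {r : I → P → ℕ}

/-- A finite set `S` is dominating for the rankings `r i` if no point lies, in every ranking,
strictly above the lowest point of `S`.  The empty set is dominating as soon as there is a
ranking. -/
def IsDominating (r : I → P → ℕ) (S : Finset P) : Prop :=
  ∀ t, ∃ i, ∀ x ∈ S, r i t ≤ r i x

lemma IsDominating.mono {S T : Finset P} (hT : IsDominating r T) (h : S ⊆ T) :
    IsDominating r S := fun t => by
  obtain ⟨i, hi⟩ := hT t
  exact ⟨i, fun x hx => hi x (h hx)⟩

variable [Fintype I] [DecidableEq I] [DecidableEq P]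

/-- A surjection onto a set with one element less than the domain identifies exactly one pair. -/
lemma exists_unique_collision {f : I → P} {τ : Finset P} (hf : Finset.univ.image f = τ)
    (hτ : τ.card + 1 = Fintype.card I) :
    ∃ a b, a ≠ b ∧ f a = f b ∧ ∀ i j, i ≠ j → f i = f j → i = a ∧ j = b ∨ i = b ∧ j = a := by
  have hlt : τ.card < (Finset.univ : Finset I).card := by rw [Finset.card_univ]; omega
  obtain ⟨a, -, b, -, hab, hfab⟩ := Finset.exists_ne_map_eq_of_card_lt_of_maps_to hlt
    (f := f) (fun i _ => by rw [← hf]; exact Finset.mem_image_of_mem _ (Finset.mem_univ i))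
  have key : ∀ a b, a ≠ b → f a = f b → Set.InjOn f (Finset.univ.erase a : Finset I) := by
    intro a b hab hfab
    apply Finset.injOn_of_card_image_eq
    have : (Finset.univ.erase a).image f = τ := by
      rw [← hf]
      ext x
      simp only [Finset.mem_image, Finset.mem_erase, Finset.mem_univ, and_true, true_and]
      constructor
      · rintro ⟨i, -, rfl⟩; exact ⟨i, rfl⟩
      · rintro ⟨i, rfl⟩
        by_cases h : i = a
        · exact ⟨b, hab.symm, by rw [h, hfab]⟩
        · exact ⟨i, h, rfl⟩
    rw [this, Finset.card_erase_of_mem (Finset.mem_univ _), Finset.card_univ]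
    omega
  have ha := key a b hab hfab
  have hb := key b a hab.symm hfab.symm
  refine ⟨a, b, hab, hfab, fun i j hij hfij => ?_⟩
  simp only [Set.InjOn, Finset.coe_erase, Finset.coe_univ, Set.mem_sdiff, Set.mem_univ,
    Set.mem_singleton_iff, true_and] at ha hb
  have h1 : i = a ∨ j = a := by
    by_contra! h
    exact hij (ha h.1 h.2 hfij)
  have h2 : i = b ∨ j = b := by
    by_contra! h
    exact hij (hb h.1 h.2 hfij)
  rcases h1 with rfl | rfl <;> rcases h2 with h2 | h2 <;> tauto

/-- Let `f i` be the lowest point of `τ` in the ranking `i`, and let `a` and `b` share theirs.  If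
some points beat `τ` in all rankings but the `a`-th, then exactly one of them can be added to `τ`
as its lowest point in the `a`-th ranking, namely the highest of them in that ranking. -/
lemma exists_isDominating_insert_of_lowest [Finite P] (hr : ∀ i, Function.Injective (r i))
    {τ : Finset P} (hdom : IsDominating r τ) {f : I → P} (hfτ : ∀ i, f i ∈ τ)
    (hfmin : ∀ i, ∀ x ∈ τ, r i (f i) ≤ r i x) (hfsurj : ∀ x ∈ τ, ∃ i, f i = x)
    {a b : I} (hab : a ≠ b) (hfab : f a = f b)
    (hM : ∃ t, ∀ i, i ≠ a → r i (f i) < r i t) :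
    ∃ y, (y ∉ τ ∧ IsDominating r (insert y τ) ∧ ∀ i, i ≠ a → r i (f i) < r i y) ∧
      r a y < r a (f a) ∧
      ∀ y', y' ∉ τ → IsDominating r (insert y' τ) → (∀ i, i ≠ a → r i (f i) < r i y') →
        r a y' < r a (f a) → y' = y := by
  obtain ⟨y, hyM, hymax⟩ := Set.exists_max_image {t | ∀ i, i ≠ a → r i (f i) < r i t} (r a)
    (Set.toFinite _) hM
  simp only [Set.mem_ofPred_eq] at hyM hymax
  have hyτ : y ∉ τ := by
    intro hy
    obtain ⟨i, hi⟩ := hfsurj y hy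
    by_cases h : i = a
    · subst h
      have := hyM b hab.symm
      rw [← hfab, hi] at this
      exact lt_irrefl _ this
    · have := hyM i h
      rw [hi] at this
      exact lt_irrefl _ this
  have hya : r a y < r a (f a) := by
    obtain ⟨i, hi⟩ := hdom y
    by_cases h : i = a
    · subst h
      refine lt_of_le_of_ne (hi _ (hfτ i)) fun h => hyτ ?_
      rw [hr i h]; exact hfτ i
    · exact absurd (hi _ (hfτ i)) (not_le.2 (hyM i h))
  refine ⟨y, ⟨hyτ, fun t => ?_, hyM⟩, hya, ?_⟩
  · by_cases ht : ∀ i, i ≠ a → r i (f i) < r i t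
    · refine ⟨a, fun x hx => ?_⟩
      rcases Finset.mem_insert.1 hx with rfl | hx
      · exact hymax t ht
      · exact (hymax t ht).trans (hya.le.trans (hfmin a x hx))
    · push Not at ht
      obtain ⟨i, hia, hi⟩ := ht
      refine ⟨i, fun x hx => ?_⟩
      rcases Finset.mem_insert.1 hx with rfl | hx
      · exact hi.trans (hyM i hia).le
      · exact hi.trans (hfmin i x hx)
  · intro y' hy'τ hy'dom hy'M hy'a
    apply hr a
    refine le_antisymm (hymax y' hy'M) ?_
    obtain ⟨i, hi⟩ := hy'dom y
    by_cases h : i = a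
    · subst h; exact hi _ (Finset.mem_insert_self _ _)
    · exact absurd (hi _ (Finset.mem_insert_of_mem (hfτ i))) (not_le.2 (hyM i h))

/-- A dominating set with one point less than there are rankings extends to a dominating set by
exactly two points, provided that no ranking can be dropped. -/
lemma exists_pair_isDominating_insert [Finite P] (hr : ∀ i, Function.Injective (r i))
    {τ : Finset P} (hτ : τ.Nonempty) (hdom : IsDominating r τ)
    (hcard : τ.card + 1 = Fintype.card I)
    (hM : ∀ a b, a ≠ b → (∀ x ∈ τ, (∀ z ∈ τ, r a x ≤ r a z) → ∀ z ∈ τ, r b x ≤ r b z) →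
      ∃ t, ∀ i, i ≠ a → ∃ x ∈ τ, r i x < r i t) :
    ∃ y₁ y₂, y₁ ≠ y₂ ∧ ∀ y, (y ∉ τ ∧ IsDominating r (insert y τ)) ↔ y = y₁ ∨ y = y₂ := by
  choose f hfτ hfmin using fun i => Finset.exists_min_image τ (r i) hτ
  have hfuniq : ∀ i, ∀ x ∈ τ, (∀ z ∈ τ, r i x ≤ r i z) → f i = x := fun i x hx h =>
    hr i (le_antisymm (hfmin i x hx) (h _ (hfτ i)))
  have hfsurj : ∀ x ∈ τ, ∃ i, f i = x := fun x hx => by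
    obtain ⟨i, hi⟩ := hdom x
    exact ⟨i, hfuniq i x hx hi⟩
  obtain ⟨a, b, hab, hfab, huniq⟩ := exists_unique_collision (f := f) (τ := τ) (by
    ext x
    simp only [Finset.mem_image, Finset.mem_univ, true_and]
    exact ⟨by rintro ⟨i, rfl⟩; exact hfτ i, hfsurj x⟩) hcard
  have hM' : ∀ a b, a ≠ b → f a = f b → ∃ t, ∀ i, i ≠ a → r i (f i) < r i t := by
    intro a b hab hfab
    obtain ⟨t, ht⟩ := hM a b hab (fun x hx h => by
      rw [← hfuniq a x hx h, hfab]; exact hfmin b)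
    refine ⟨t, fun i hi => ?_⟩
    obtain ⟨x, hx, hxt⟩ := ht i hi
    exact (hfmin i x hx).trans_lt hxt
  obtain ⟨y₁, ⟨h1τ, h1d, h1M⟩, h1a, h1u⟩ := exists_isDominating_insert_of_lowest hr hdom hfτ hfmin
    hfsurj hab hfab (hM' a b hab hfab)
  obtain ⟨y₂, ⟨h2τ, h2d, h2M⟩, h2a, h2u⟩ := exists_isDominating_insert_of_lowest hr hdom hfτ hfmin
    hfsurj hab.symm hfab.symm (hM' b a hab.symm hfab.symm)
  refine ⟨y₁, y₂, ?_, fun y => ⟨?_, ?_⟩⟩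
  · rintro rfl
    exact lt_asymm h1a (h2M a hab)
  · rintro ⟨hyτ, hyd⟩
    have hne : ∀ i, r i y ≠ r i (f i) := fun i h => hyτ (by rw [hr i h]; exact hfτ i)
    -- every old point must remain the lowest one of some ranking
    have hold : ∀ x ∈ τ, ∃ k, f k = x ∧ r k (f k) < r k y := fun x hx => by
      obtain ⟨k, hk⟩ := hyd x
      have hkx := hfuniq k x hx fun z hz => hk z (Finset.mem_insert_of_mem hz)
      refine ⟨k, hkx, lt_of_le_of_ne ?_ (hne k).symm⟩
      rw [hkx]; exact hk y (Finset.mem_insert_self _ _)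
    -- so the new point can be the lowest one only in the rankings `a` and `b`, and not in both
    have honly : ∀ i, r i y < r i (f i) → i = a ∨ i = b := fun i hi => by
      obtain ⟨k, hk, hky⟩ := hold (f i) (hfτ i)
      have hik : i ≠ k := by rintro rfl; exact lt_asymm hi hky
      rcases huniq i k hik hk.symm with h | h
      · exact Or.inl h.1
      · exact Or.inr h.1
    have hnot : ¬ (r a y < r a (f a) ∧ r b y < r b (f b)) := fun ⟨ha, hb⟩ => by
      obtain ⟨k, hk, hky⟩ := hold (f a) (hfτ a)
      have hak : a ≠ k := by rintro rfl; exact lt_asymm ha hky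
      rcases huniq a k hak hk.symm with h | h
      · rw [h.2] at hky; exact lt_asymm hb hky
      · exact hak h.2.symm
    have hlt : ∀ i, ¬ r i y < r i (f i) → r i (f i) < r i y := fun i h =>
      lt_of_le_of_ne (not_lt.1 h) (hne i).symm
    obtain ⟨i, hi⟩ := hyd y
    have hi' : r i y < r i (f i) :=
      lt_of_le_of_ne (hi _ (Finset.mem_insert_of_mem (hfτ i))) (hne i)
    rcases honly i hi' with rfl | rfl
    · refine Or.inl (h1u y hyτ hyd (fun j hj => hlt j fun h => ?_) hi')
      rcases honly j h with rfl | rfl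
      · exact hj rfl
      · exact hnot ⟨hi', h⟩
    · refine Or.inr (h2u y hyτ hyd (fun j hj => hlt j fun h => ?_) hi')
      rcases honly j h with rfl | rfl
      · exact hnot ⟨h, hi'⟩
      · exact hj rfl
  · rintro (rfl | rfl)
    · exact ⟨h1τ, h1d⟩
    · exact ⟨h2τ, h2d⟩

/-- In a set of `Fintype.card I` points that does not carry all the colours, the number of points
whose removal leaves precisely the colours other than `i₀` is even: it is zero, or there are two
such points, which share their colour. -/
lemma even_card_filter_image_erase (c : P → I) (i₀ : I) {S : Finset P}
    (hS : S.card = Fintype.card I) (hc : S.image c ≠ Finset.univ) :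
    Even (S.filter fun x => (S.erase x).image c = Finset.univ.erase i₀).card := by
  rcases (S.filter fun x => (S.erase x).image c = Finset.univ.erase i₀).eq_empty_or_nonempty with
    h | ⟨x, hx⟩
  · simp [h]
  obtain ⟨hxS, hx⟩ := Finset.mem_filter.1 hx
  have hinj : Set.InjOn c (S.erase x : Finset P) := by
    apply Finset.injOn_of_card_image_eq
    rw [hx, Finset.card_erase_of_mem hxS, Finset.card_erase_of_mem (Finset.mem_univ _), hS,
      Finset.card_univ]
  have hcx : c x ≠ i₀ := fun h => hc (by
    rw [← Finset.insert_erase hxS, Finset.image_insert, hx, h,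
      Finset.insert_erase (Finset.mem_univ _)])
  have : c x ∈ (S.erase x).image c := by rw [hx]; simp [hcx]
  obtain ⟨x', hx', hcx'⟩ := Finset.mem_image.1 this
  have hx'S := Finset.mem_of_mem_erase hx'
  have hne : x' ≠ x := Finset.ne_of_mem_erase hx'
  suffices (S.filter fun x => (S.erase x).image c = Finset.univ.erase i₀) = {x, x'} by
    rw [this, Finset.card_pair hne.symm]; exact even_two
  ext y
  simp only [Finset.mem_filter, Finset.mem_insert, Finset.mem_singleton]
  constructor
  · rintro ⟨hyS, hy⟩
    by_contra! hyn
    have hyi : c y ≠ i₀ := by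
      have : c y ∈ (S.erase x).image c :=
        Finset.mem_image_of_mem _ (Finset.mem_erase.2 ⟨hyn.1, hyS⟩)
      rw [hx] at this
      exact Finset.ne_of_mem_erase this
    have : c y ∈ (S.erase y).image c := by rw [hy]; simp [hyi]
    obtain ⟨z, hz, hzy⟩ := Finset.mem_image.1 this
    obtain ⟨hzne, hzS⟩ := Finset.mem_erase.1 hz
    have hy' : y ∈ S.erase x := Finset.mem_erase.2 ⟨hyn.1, hyS⟩
    by_cases hzx : z = x
    · subst hzx
      exact hyn.2 (hinj hy' hx' (hzy.symm.trans hcx'.symm))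
    · exact hzne (hinj (Finset.mem_erase.2 ⟨hzx, hzS⟩) hy' hzy)
  · rintro (rfl | rfl)
    · exact ⟨hxS, hx⟩
    · refine ⟨hx'S, ?_⟩
      rw [← hx]
      ext i
      simp only [Finset.mem_image, Finset.mem_erase]
      constructor
      · rintro ⟨z, ⟨hz1, hz2⟩, rfl⟩
        by_cases hzx : z = x
        · exact ⟨y, ⟨hne, hx'S⟩, by rw [hzx, hcx']⟩
        · exact ⟨z, ⟨hzx, hz2⟩, rfl⟩
      · rintro ⟨z, ⟨hz1, hz2⟩, rfl⟩
        by_cases hzx : z = y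
        · exact ⟨x, ⟨hne.symm, hxS⟩, by rw [hzx, hcx']⟩
        · exact ⟨z, ⟨hzx, hz2⟩, rfl⟩

/-- The sets obtained by adding a point to `τ`, counted by the added point. -/
lemma card_filter_superset_eq [Fintype P] {n : ℕ} (p : Finset P → Prop) [DecidablePred p]
    {τ : Finset P} (hτ : τ.card + 1 = n) :
    (Finset.univ.filter fun S : Finset P => (S.card = n ∧ p S) ∧ τ ⊆ S).card =
      (Finset.univ.filter fun y => y ∉ τ ∧ p (insert y τ)).card := by
  symm
  apply Finset.card_bij (fun y _ => insert y τ)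
  · intro y hy
    simp only [Finset.mem_filter, Finset.mem_univ, true_and] at hy ⊢
    exact ⟨⟨by rw [Finset.card_insert_of_notMem hy.1, hτ], hy.2⟩, Finset.subset_insert _ _⟩
  · intro y hy z hz h
    simp only [Finset.mem_filter, Finset.mem_univ, true_and] at hy hz
    have : y ∈ insert z τ := h ▸ Finset.mem_insert_self y τ
    exact (Finset.mem_insert.1 this).resolve_right hy.1
  · intro S hS
    simp only [Finset.mem_filter, Finset.mem_univ, true_and] at hS
    obtain ⟨⟨hSc, hSp⟩, hτS⟩ := hS
    have : (S \ τ).card = 1 := by rw [Finset.card_sdiff_of_subset hτS]; omega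
    obtain ⟨y, hy⟩ := Finset.card_eq_one.1 this
    have hS' : insert y τ = S := by
      rw [Finset.insert_eq, ← hy, Finset.sdiff_union_of_subset hτS]
    refine ⟨y, ?_, hS'⟩
    have : y ∈ S \ τ := by rw [hy]; simp
    simp only [Finset.mem_filter, Finset.mem_univ, true_and]
    exact ⟨(Finset.mem_sdiff.1 this).2, hS' ▸ hSp⟩

/-- The subsets of `S` with one point less, counted by the removed point. -/
lemma card_filter_subset_eq [Fintype P] {n : ℕ} (p : Finset P → Prop) [DecidablePred p]
    {S : Finset P} (hS : S.card = n) :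
    (Finset.univ.filter fun τ : Finset P => (τ.card + 1 = n ∧ p τ) ∧ τ ⊆ S).card =
      (S.filter fun x => p (S.erase x)).card := by
  symm
  apply Finset.card_bij (fun x _ => S.erase x)
  · intro x hx
    simp only [Finset.mem_filter, Finset.mem_univ, true_and] at hx ⊢
    exact ⟨⟨by rw [Finset.card_erase_add_one hx.1, hS], hx.2⟩, Finset.erase_subset _ _⟩
  · intro x hx z hz h
    simp only [Finset.mem_filter] at hx hz
    exact (Finset.erase_inj S hx.1).1 h
  · intro τ hτ
    simp only [Finset.mem_filter, Finset.mem_univ, true_and] at hτ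
    obtain ⟨⟨hτc, hτp⟩, hτS⟩ := hτ
    have : (S \ τ).card = 1 := by rw [Finset.card_sdiff_of_subset hτS]; omega
    obtain ⟨y, hy⟩ := Finset.card_eq_one.1 this
    have hS' : S.erase y = τ := by
      rw [← Finset.sdiff_singleton_eq_erase, ← hy, Finset.sdiff_sdiff_eq_self hτS]
    have : y ∈ S \ τ := by rw [hy]; simp
    exact ⟨y, Finset.mem_filter.2 ⟨(Finset.mem_sdiff.1 this).1, hS'.symm ▸ hτp⟩, hS'⟩

/-- **Scarf's combinatorial lemma.**  Let finitely many points be ranked injectively by `r i`,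
`i : I`, where the slack point `e i` comes lowest in the `i`-th ranking and above all proper
points in the others.  If the points are coloured by `I`, the slack point `e i` getting the colour
`i`, then some dominating set has one point of each colour.

Double counting of the pairs `τ ⊆ S`, where `S` is dominating with `Fintype.card I` points and `τ`
has the colours other than `i₀`, once each: every such dominating `τ` lies in two sets `S`, except
for `τ = {e j | j ≠ i₀}`, which lies in one; and an `S` lacking a colour contains an even number of
sets `τ`. -/
theorem exists_isDominating_image_eq_univ [Nonempty I] [Fintype P]
    (hr : ∀ i, Function.Injective (r i))
    {e : I → P} (he_low : ∀ i p, p ≠ e i → r i (e i) < r i p)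
    (he_high : ∀ i j p, j ≠ i → p ∉ Set.range e → r i p < r i (e j))
    (he : ∃ p, p ∉ Set.range e) {c : P → I} (hc : ∀ i, c (e i) = i) :
    ∃ S : Finset P, S.card = Fintype.card I ∧ IsDominating r S ∧ S.image c = Finset.univ := by
  classical
  by_contra! hno
  obtain ⟨i₀⟩ := ‹Nonempty I›
  have heinj : Function.Injective e := fun i j h => by rw [← hc i, h, hc]
  set rooms := Finset.univ.filter fun S : Finset P => S.card = Fintype.card I ∧ IsDominating r S
    with hrooms
  set doors := Finset.univ.filter fun τ : Finset P => τ.card + 1 = Fintype.card I ∧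
    (IsDominating r τ ∧ τ.image c = Finset.univ.erase i₀) with hdoors
  set τ₀ : Finset P := (Finset.univ.erase i₀).image e with hτ₀
  have hτ₀mem : ∀ j, j ≠ i₀ → e j ∈ τ₀ := fun j hj => by
    rw [hτ₀]; exact Finset.mem_image_of_mem _ (by simp [hj])
  have hcount := Finset.sum_card_bipartiteAbove_eq_sum_card_bipartiteBelow
    (s := doors) (t := rooms) (fun τ S => τ ⊆ S)
  have hτ₀card : τ₀.card + 1 = Fintype.card I := by
    rw [hτ₀, Finset.card_image_of_injective _ heinj, Finset.card_erase_add_one (Finset.mem_univ _),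
      Finset.card_univ]
  have hleft : ∀ S ∈ rooms, Even (Finset.bipartiteBelow (fun τ S => τ ⊆ S) doors S).card := by
    intro S hS
    obtain ⟨hSc, hSd⟩ := (Finset.mem_filter.1 hS).2
    have h := card_filter_subset_eq
      (fun τ => IsDominating r τ ∧ τ.image c = Finset.univ.erase i₀) hSc
    rw [Finset.bipartiteBelow, hdoors, Finset.filter_filter, h]
    convert even_card_filter_image_erase c i₀ hSc (hno S hSc hSd) using 3
    exact and_iff_right (hSd.mono (Finset.erase_subset _ _))
  have hright : ∀ τ ∈ doors, τ ≠ τ₀ →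
      Even (Finset.bipartiteAbove (fun τ S => τ ⊆ S) rooms τ).card := by
    intro τ hτ hne
    obtain ⟨hτc, hτd, hτcol⟩ := (Finset.mem_filter.1 hτ).2
    obtain ⟨q, hqτ, hq⟩ : ∃ q ∈ τ, q ∉ Set.range e := by
      by_contra! h
      refine hne (Finset.eq_of_subset_of_card_le (fun x hx => ?_) (by omega))
      obtain ⟨j, rfl⟩ := h x hx
      apply hτ₀mem
      have : c (e j) ∈ τ.image c := Finset.mem_image_of_mem _ hx
      rw [hτcol, hc] at this
      exact Finset.ne_of_mem_erase this
    rw [Finset.bipartiteAbove, hrooms, Finset.filter_filter, card_filter_superset_eq _ hτc]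
    obtain ⟨y₁, y₂, hy, hiff⟩ := exists_pair_isDominating_insert hr ⟨q, hqτ⟩ hτd hτc (by
      intro a b hab h
      -- the slack point of `a` beats `τ` in all other rankings
      have hea : e a ∉ τ := fun hea => by
        have h1 := h _ hea (fun z hz => by
          rcases eq_or_ne z (e a) with rfl | hz
          · exact le_rfl
          · exact (he_low a z hz).le) q hqτ
        exact absurd h1 (not_le.2 (he_high b a q hab hq))
      exact ⟨e a, fun i hi => ⟨q, hqτ, he_high i a q hi.symm hq⟩⟩)
    have : (Finset.univ.filter fun y => y ∉ τ ∧ IsDominating r (insert y τ)) = {y₁, y₂} := by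
      ext y; simp [hiff]
    rw [this, Finset.card_pair hy]
    exact even_two
  have hτ₀one : (Finset.bipartiteAbove (fun τ S => τ ⊆ S) rooms τ₀).card = 1 := by
    rw [Finset.bipartiteAbove, hrooms, Finset.filter_filter, card_filter_superset_eq _ hτ₀card,
      Finset.card_eq_one]
    obtain ⟨y, hyT, hymax⟩ := Set.exists_max_image {p | p ∉ Set.range e} (r i₀) (Set.toFinite _) he
    refine ⟨y, ?_⟩
    ext z
    simp only [Finset.mem_filter, Finset.mem_univ, true_and, Finset.mem_singleton]
    constructor
    · rintro ⟨hz, hzd⟩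
      -- a proper point can be below `insert z τ₀` only in the ranking `i₀`
      have hlow : ∀ t, t ∉ Set.range e → r i₀ t ≤ r i₀ z := fun t ht => by
        obtain ⟨i, hi⟩ := hzd t
        have hii : i = i₀ := by
          by_contra hii
          refine absurd (hi (e i) (Finset.mem_insert_of_mem (hτ₀mem i hii))) (not_le.2 ?_)
          exact he_low i t fun h => ht ⟨i, h.symm⟩
        rw [← hii]
        exact hi z (Finset.mem_insert_self _ _)
      have hzT : z ∉ Set.range e := by
        rintro ⟨j, rfl⟩
        by_cases hj : j = i₀
        · subst hj
          exact absurd (hlow y hyT) (not_le.2 (he_low j y fun h => hyT ⟨j, h.symm⟩))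
        · exact hz (hτ₀mem j hj)
      exact hr i₀ (le_antisymm (hymax z hzT) (hlow y hyT))
    · rintro rfl
      refine ⟨fun h => ?_, fun t => ?_⟩
      · obtain ⟨j, -, hj⟩ := Finset.mem_image.1 h
        exact hyT ⟨j, hj⟩
      · by_cases ht : t ∈ Set.range e
        · obtain ⟨j, rfl⟩ := ht
          refine ⟨j, fun x _ => ?_⟩
          rcases eq_or_ne x (e j) with rfl | hx
          · exact le_rfl
          · exact (he_low j x hx).le
        · refine ⟨i₀, fun x hx => ?_⟩
          rcases Finset.mem_insert.1 hx with rfl | hx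
          · exact hymax t ht
          · obtain ⟨j, hj, rfl⟩ := Finset.mem_image.1 hx
            exact (he_high i₀ j t (Finset.ne_of_mem_erase hj) ht).le
  have hτ₀door : τ₀ ∈ doors := by
    rw [hdoors, Finset.mem_filter]
    refine ⟨Finset.mem_univ _, hτ₀card, ?_, ?_⟩
    · have : (Finset.bipartiteAbove (fun τ S => τ ⊆ S) rooms τ₀).Nonempty := by
        rw [← Finset.card_pos, hτ₀one]; exact one_pos
      obtain ⟨S, hS⟩ := this
      obtain ⟨hS, hsub⟩ := Finset.mem_filter.1 hS
      exact (Finset.mem_filter.1 hS).2.2.mono hsub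
    · rw [hτ₀, Finset.image_image, show c ∘ e = id from funext hc, Finset.image_id]
  rw [← Finset.add_sum_erase _ _ hτ₀door, hτ₀one] at hcount
  have h1 : Even (∑ S ∈ rooms, (Finset.bipartiteBelow (fun τ S => τ ⊆ S) doors S).card) :=
    Finset.even_sum _ hleft
  have h2 : Even (∑ τ ∈ doors.erase τ₀,
      (Finset.bipartiteAbove (fun τ S => τ ⊆ S) rooms τ).card) :=
    Finset.even_sum _ fun τ hτ => hright τ (Finset.mem_of_mem_erase hτ) (Finset.ne_of_mem_erase hτ)
  rw [← hcount] at h1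
  exact absurd h1 (by rw [add_comm, Nat.even_add_one]; exact not_not.2 h2)

end Scarf

/-! ### Closed coverings of the simplex -/

section Simplex

variable {I : Type*} [Fintype I] [Nonempty I]

/-- Scarf's lemma for the grid points `a : I → ℕ` with `∑ i, a i = m`, ranked by their
coordinates: near some grid point `p` there are grid points of all colours `i` but those for which
`p` itself is near the `i`-th facet. -/
lemma exists_near_all_colours (m : ℕ) (c : (I → ℕ) → I) :
    ∃ p : I → ℕ, ∑ i, p i = m ∧ ∀ i, p i ≤ Fintype.card I ∨
      ∃ b : I → ℕ, ∑ k, b k = m ∧ c b = i ∧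
        ∀ k, b k ≤ p k + Fintype.card I ∧ p k ≤ b k + Fintype.card I := by
  classical
  -- the points to be ranked are the grid points and one slack point for each coordinate
  let T := Finset.piAntidiag (Finset.univ : Finset I) m
  have hT : ∀ a : I → ℕ, ∑ i, a i = m → a ∈ T := fun a ha => by simp [T, ha]
  have hT' : ∀ a : T, ∑ i, a.1 i = m := fun a => (Finset.mem_piAntidiag.1 a.2).1
  have hTle : ∀ (a : T) i, a.1 i ≤ m := fun a i => by
    rw [← hT' a]; exact Finset.single_le_sum (fun _ _ => Nat.zero_le _) (Finset.mem_univ i)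
  let P := T ⊕ I
  let coord : I → P → ℕ := fun i => Sum.elim (fun a => a.1 i + 1) fun j => if j = i then 0 else m + 2
  let q := Fintype.card P
  let κ : P ≃ Fin q := Fintype.equivFin P
  -- ties between coordinates are broken by the enumeration `κ`
  let r : I → P → ℕ := fun i x => coord i x * q + κ x
  have hr_lt : ∀ i x y, coord i x < coord i y → r i x < r i y := fun i x y h => by
    have h1 : (coord i x + 1) * q ≤ coord i y * q := Nat.mul_le_mul_right _ h
    have h2 := (κ x).2
    simp only [r]
    rw [add_mul] at h1
    omega
  have hr_inj : ∀ i, Function.Injective (r i) := fun i x y h => by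
    have hc : coord i x = coord i y := by
      by_contra hne
      rcases lt_or_gt_of_ne hne with hlt | hlt
      · exact (hr_lt i x y hlt).ne h
      · exact (hr_lt i y x hlt).ne h.symm
    apply κ.injective
    apply Fin.ext
    simp only [r, hc] at h
    omega
  have hnr : ∀ a : T, (Sum.inl a : P) ∉ Set.range (Sum.inr : I → P) := by rintro a ⟨j, hj⟩; cases hj
  obtain ⟨i₁⟩ := ‹Nonempty I›
  let a₁ : T := ⟨Pi.single i₁ m, hT _ (by simp)⟩
  obtain ⟨S, hScard, hSdom, hScol⟩ := exists_isDominating_image_eq_univ (r := r) hr_inj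
    (e := (Sum.inr : I → P))
    (fun i x hx => by
      apply hr_lt
      rcases x with a | j
      · simp [coord]
      · have : j ≠ i := fun h => hx (by rw [h])
        simp [coord, this])
    (fun i j x hji hx => by
      apply hr_lt
      rcases x with a | k
      · have := hTle a i
        simp only [coord, Sum.elim_inl, Sum.elim_inr, hji, if_false]
        omega
      · exact absurd ⟨k, rfl⟩ hx)
    ⟨Sum.inl a₁, hnr a₁⟩ (c := Sum.elim (fun a => c a.1) id) (fun _ => rfl)
  -- the colours of the grid points in `S` are those whose slack point is not in `S`
  let C := Finset.univ.filter fun i => (Sum.inr i : P) ∉ S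
  have hdom : ∀ a : T, ∃ i ∈ C, ∀ b : T, Sum.inl b ∈ S → a.1 i ≤ b.1 i := fun a => by
    obtain ⟨i, hi⟩ := hSdom (Sum.inl a)
    have hi' : ∀ x ∈ S, coord i (Sum.inl a) ≤ coord i x := fun x hx =>
      not_lt.1 fun h => absurd (hi x hx) (not_le.2 (hr_lt i _ _ h))
    refine ⟨i, ?_, fun b hb => ?_⟩
    · simp only [C, Finset.mem_filter, Finset.mem_univ, true_and]
      intro h
      simpa [coord] using hi' _ h
    · simpa [coord] using hi' _ hb
  have hcol : ∀ i ∈ C, ∃ b : T, Sum.inl b ∈ S ∧ c b.1 = i := fun i hi => by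
    have : i ∈ S.image (Sum.elim (fun a : T => c a.1) id) := by rw [hScol]; exact Finset.mem_univ i
    obtain ⟨x, hx, hxi⟩ := Finset.mem_image.1 this
    rcases x with b | j
    · exact ⟨b, hx, hxi⟩
    · simp only [Sum.elim_inr, id] at hxi
      subst hxi
      exact absurd hx (Finset.mem_filter.1 hi).2
  obtain ⟨i₂, hi₂, -⟩ := hdom a₁
  obtain ⟨p, hpS, -⟩ := hcol i₂ hi₂
  have hμ : ∀ i, ∃ k, (∀ b : T, Sum.inl b ∈ S → k ≤ b.1 i) ∧ ∃ b : T, Sum.inl b ∈ S ∧ b.1 i = k :=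
    fun i => by
      obtain ⟨b, hb, hbmin⟩ := Set.exists_min_image {b : T | Sum.inl b ∈ S} (fun b => b.1 i)
        (Set.toFinite _) ⟨p, hpS⟩
      exact ⟨b.1 i, hbmin, b, hb, rfl⟩
  choose μ hμle hμmem using hμ
  -- otherwise a grid point would exceed `μ` in all the coordinates of `C`
  have hμsum : m < ∑ i ∈ C, (μ i + 1) := by
    by_contra! hle
    let a : I → ℕ := fun i => (if i ∈ C then μ i + 1 else 0) +
      if i = i₂ then m - ∑ i ∈ C, (μ i + 1) else 0
    have ha : ∑ i, a i = m := by
      simp only [a, Finset.sum_add_distrib (s := Finset.univ), Finset.sum_ite_mem,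
        Finset.univ_inter, Finset.sum_ite_eq', Finset.mem_univ, if_true]
      omega
    obtain ⟨i, hiC, hi⟩ := hdom ⟨a, hT a ha⟩
    obtain ⟨b, hb, hbμ⟩ := hμmem i
    have := hi b hb
    simp only [a, hiC, if_true, hbμ] at this
    omega
  have hCcard : C.card ≤ Fintype.card I := Finset.card_le_univ C
  rw [Finset.sum_add_distrib, Finset.sum_const, smul_eq_mul, mul_one] at hμsum
  have hin : ∀ b : T, Sum.inl b ∈ S → ∀ i ∈ C, b.1 i ≤ μ i + Fintype.card I := fun b hb i hi => by
    have h1 : ∑ k ∈ C.erase i, μ k ≤ ∑ k ∈ C.erase i, b.1 k :=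
      Finset.sum_le_sum fun k _ => hμle k b hb
    have h2 := Finset.add_sum_erase C μ hi
    have h3 := Finset.add_sum_erase C b.1 hi
    have h4 : ∑ k ∈ C, b.1 k ≤ ∑ k, b.1 k :=
      Finset.sum_le_sum_of_subset (Finset.subset_univ C)
    rw [hT' b] at h4
    omega
  have hout : ∀ b : T, Sum.inl b ∈ S → ∀ i ∉ C, b.1 i ≤ Fintype.card I := fun b hb i hi => by
    have h1 : ∑ k ∈ C, μ k ≤ ∑ k ∈ C, b.1 k := Finset.sum_le_sum fun k _ => hμle k b hb
    have h2 := Finset.sum_insert (f := b.1) hi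
    have h3 : ∑ k ∈ insert i C, b.1 k ≤ ∑ k, b.1 k :=
      Finset.sum_le_sum_of_subset (Finset.subset_univ _)
    rw [hT' b] at h3
    omega
  refine ⟨p.1, hT' p, fun i => ?_⟩
  by_cases hi : i ∈ C
  · obtain ⟨b, hb, hbi⟩ := hcol i hi
    refine Or.inr ⟨b.1, hT' b, hbi, fun k => ?_⟩
    by_cases hk : k ∈ C
    · have := hin b hb k hk
      have := hin p hpS k hk
      have := hμle k b hb
      have := hμle k p hpS
      omega
    · have := hout b hb k hk
      have := hout p hpS k hk
      omega
  · exact Or.inl (hout p hpS i hi)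

/-- If closed sets `F i` cover the standard simplex and `F i` contains its `i`-th facet, they have
a common point in the simplex (a dual form of the Knaster-Kuratowski-Mazurkiewicz lemma). -/
theorem exists_mem_stdSimplex_forall_mem {F : I → Set (I → ℝ)} (hF : ∀ i, IsClosed (F i))
    (hcover : ∀ p ∈ stdSimplex ℝ I, ∃ i, p ∈ F i)
    (hfacet : ∀ p ∈ stdSimplex ℝ I, ∀ i, p i = 0 → p ∈ F i) :
    ∃ p ∈ stdSimplex ℝ I, ∀ i, p ∈ F i := by
  set n := Fintype.card I
  let ε : ℕ → ℝ := fun m => n / ((m : ℝ) + 1)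
  have hε : Filter.Tendsto ε Filter.atTop (nhds 0) :=
    tendsto_const_div_atTop_nhds_zero_nat (n : ℝ) |>.comp (Filter.tendsto_add_atTop_nat 1) |>.congr
      fun m => by simp [ε]
  have hgrid : ∀ (m : ℕ) (a : I → ℕ), ∑ i, a i = m + 1 →
      (fun i => (a i : ℝ) / ((m : ℝ) + 1)) ∈ stdSimplex ℝ I := fun m a ha => by
    refine ⟨fun i => by positivity, ?_⟩
    rw [← Finset.sum_div, ← Nat.cast_sum, ha]
    push_cast
    exact div_self (by positivity)
  have hstep : ∀ m : ℕ, ∃ u ∈ stdSimplex ℝ I, ∀ i, u i ≤ ε m ∨ ∃ x ∈ F i, dist x u ≤ ε m := by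
    intro m
    have hcol : ∀ a : I → ℕ, ∃ i, ∑ k, a k = m + 1 → (fun k => (a k : ℝ) / ((m : ℝ) + 1)) ∈ F i := by
      intro a
      by_cases ha : ∑ k, a k = m + 1
      · obtain ⟨i, hi⟩ := hcover _ (hgrid m a ha)
        exact ⟨i, fun _ => hi⟩
      · exact ⟨Classical.arbitrary I, fun h => absurd h ha⟩
    choose c hc using hcol
    obtain ⟨p, hp, hpc⟩ := exists_near_all_colours (m + 1) c
    refine ⟨_, hgrid m p hp, fun i => ?_⟩
    have hm : (0 : ℝ) < (m : ℝ) + 1 := by positivity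
    rcases hpc i with h | ⟨b, hb, hbi, hbp⟩
    · exact Or.inl (div_le_div_of_nonneg_right (by exact_mod_cast h) hm.le)
    · refine Or.inr ⟨_, hbi ▸ hc b hb, ?_⟩
      rw [dist_pi_le_iff (by positivity)]
      intro k
      have h1 : (b k : ℝ) ≤ p k + n := by exact_mod_cast (hbp k).1
      have h2 : (p k : ℝ) ≤ b k + n := by exact_mod_cast (hbp k).2
      rw [Real.dist_eq, ← sub_div, abs_div, abs_of_pos hm]
      exact div_le_div_of_nonneg_right (abs_le.2 ⟨by linarith, by linarith⟩) hm.le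
  choose u huΔ hu using hstep
  obtain ⟨p, hp, φ, hφ, hlim⟩ := (isCompact_stdSimplex ℝ I).tendsto_subseq huΔ
  refine ⟨p, hp, fun i => ?_⟩
  rcases (hp.1 i).eq_or_lt with h0 | h0
  · exact hfacet p hp i h0.symm
  · rw [← (hF i).closure_eq, Metric.mem_closure_iff]
    intro δ hδ
    have hε' := hε.comp hφ.tendsto_atTop
    have h1 : ∀ᶠ k in Filter.atTop, ε (φ k) < u (φ k) i :=
      hε'.eventually_lt ((continuous_apply i).continuousAt.tendsto.comp hlim) h0
    have h2 : ∀ᶠ k in Filter.atTop, ε (φ k) < δ / 2 := hε'.eventually_lt_const (half_pos hδ)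
    have h3 : ∀ᶠ k in Filter.atTop, dist (u (φ k)) p < δ / 2 :=
      Metric.tendsto_nhds.1 hlim _ (half_pos hδ)
    obtain ⟨k, hk1, hk2, hk3⟩ := (h1.and (h2.and h3)).exists
    rcases hu (φ k) i with h | ⟨x, hx, hxu⟩
    · exact absurd h (not_le.2 hk1)
    · refine ⟨x, hx, ?_⟩
      calc dist p x ≤ dist p (u (φ k)) + dist (u (φ k)) x := dist_triangle _ _ _
        _ < δ := by rw [dist_comm p, dist_comm _ x]; linarith

end Simplex

/-! ### Ky Fan's inequality and equilibria of convex games -/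

section KyFan

variable {E : Type*} [NormedAddCommGroup E] [NormedSpace ℝ E] {K : Set E} {φ : E → E → ℝ}

/-- Ky Fan's inequality for finitely many test points `z i`.  On the simplex of the convex
combinations `x p = ∑ i, p i • z i`, put `g i p = max (φ (x p) (z i)) 0`; the closed sets
`p i * ∑ j, g j p ≤ g i p` have a common point `p`.  If `∑ j, g j p` were positive, then
`φ (x p) (z i)` would be positive wherever `p i` is, and so would `φ (x p) (x p)`. -/
lemma exists_forall_le_zero_of_finite {I : Type*} [Fintype I] [Nonempty I] (hK : Convex ℝ K)
    (hcont : ∀ z ∈ K, ContinuousOn (fun x => φ x z) K) (hconc : ∀ x ∈ K, ConcaveOn ℝ K (φ x))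
    (hdiag : ∀ x ∈ K, φ x x ≤ 0) {z : I → E} (hz : ∀ i, z i ∈ K) :
    ∃ x ∈ K, ∀ i, φ x (z i) ≤ 0 := by
  let x : (I → ℝ) → E := fun p => ∑ i, p i • z i
  have hxK : ∀ p ∈ stdSimplex ℝ I, x p ∈ K := fun p hp =>
    hK.sum_mem (fun i _ => hp.1 i) hp.2 fun i _ => hz i
  have hx : Continuous x := by fun_prop
  let g : I → (I → ℝ) → ℝ := fun i p => max (φ (x p) (z i)) 0
  have hg : ∀ i, ContinuousOn (g i) (stdSimplex ℝ I) := fun i =>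
    ((hcont _ (hz i)).comp hx.continuousOn hxK).sup continuousOn_const
  have hg0 : ∀ i p, 0 ≤ g i p := fun i p => le_max_right _ _
  obtain ⟨p, hp, hpF⟩ := exists_mem_stdSimplex_forall_mem
    (F := fun i => {p | p ∈ stdSimplex ℝ I ∧ p i * ∑ j, g j p ≤ g i p})
    (fun i => (isClosed_stdSimplex ℝ I).isClosed_le
      ((continuous_apply i).continuousOn.mul (continuousOn_finsetSum _ fun j _ => hg j)) (hg i))
    (fun p hp => by
      by_contra! h
      have hlt : ∑ i, g i p < ∑ i, p i * ∑ j, g j p :=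
        Finset.sum_lt_sum_of_nonempty Finset.univ_nonempty fun i _ =>
          not_le.1 fun hle => h i ⟨hp, hle⟩
      rw [← Finset.sum_mul, hp.2, one_mul] at hlt
      exact lt_irrefl _ hlt)
    (fun p hp i hi => ⟨hp, by rw [hi, zero_mul]; exact hg0 i p⟩)
  refine ⟨x p, hxK p hp, fun i => ?_⟩
  rcases (Finset.sum_nonneg fun j _ => hg0 j p : 0 ≤ ∑ j, g j p).eq_or_lt with h0 | h0
  · have := (Finset.sum_eq_zero_iff_of_nonneg fun j _ => hg0 j p).1 h0.symm i (Finset.mem_univ i)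
    exact (le_max_left _ _).trans this.le
  · exfalso
    have hpos : ∀ j, 0 < p j → 0 < φ (x p) (z j) := fun j hj => by
      have : 0 < g j p := (mul_pos hj h0).trans_le (hpF j).2
      exact (lt_max_iff.1 this).resolve_right (lt_irrefl _)
    obtain ⟨j, -, hj⟩ : ∃ j ∈ Finset.univ, 0 < p j := by
      by_contra! h
      have := Finset.sum_nonpos h
      rw [hp.2] at this
      exact absurd this (by norm_num)
    have hsum : 0 < ∑ j, p j • φ (x p) (z j) := by
      refine Finset.sum_pos' (fun k _ => ?_) ⟨j, Finset.mem_univ j, mul_pos hj (hpos j hj)⟩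
      rcases (hp.1 k).eq_or_lt with hk | hk
      · rw [← hk, zero_smul]
      · exact (mul_pos hk (hpos k hk)).le
    have := (hconc _ (hxK p hp)).le_map_sum (fun i _ => hp.1 i) hp.2 fun i _ => hz i
    exact absurd (hdiag _ (hxK p hp)) (not_le.2 (hsum.trans_le this))

/-- **Ky Fan's inequality.** -/
theorem exists_forall_le_zero (hKc : IsCompact K) (hK : Convex ℝ K) (hKne : K.Nonempty)
    (hcont : ∀ z ∈ K, ContinuousOn (fun x => φ x z) K) (hconc : ∀ x ∈ K, ConcaveOn ℝ K (φ x))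
    (hdiag : ∀ x ∈ K, φ x x ≤ 0) : ∃ x ∈ K, ∀ z ∈ K, φ x z ≤ 0 := by
  obtain ⟨x, hxK, hx⟩ := hKc.inter_iInter_nonempty (fun z : K => {x | x ∈ K ∧ φ x z ≤ 0})
    (fun z => hKc.isClosed.isClosed_le (hcont z z.2) continuousOn_const) (fun u => by
      rcases u.eq_empty_or_nonempty with rfl | hu
      · simpa using hKne
      · have : Nonempty u := hu.to_subtype
        obtain ⟨x, hxK, hx⟩ := exists_forall_le_zero_of_finite hK hcont hconc hdiag
          (z := fun i : u => (i.1 : E)) fun i => i.1.2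
        exact ⟨x, hxK, Set.mem_iInter₂.2 fun z hz => ⟨hxK, hx ⟨z, hz⟩⟩⟩)
  exact ⟨x, hxK, fun z hz => (Set.mem_iInter.1 hx ⟨z, hz⟩).2⟩

end KyFan

/-- **Existence of Nash equilibria** for costs that are jointly continuous, and convex in the
player's own decision, on compact convex decision sets: Ky Fan's inequality for
`φ x z = ∑ i, (J i x - J i (x with z i in place of x i))`. -/
theorem exists_equilibrium_of_convexOn {ι V : Type*} [Fintype ι] [DecidableEq ι]
    [NormedAddCommGroup V] [NormedSpace ℝ V] {K : ι → Set V} {J : ι → (ι → V) → ℝ}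
    (hKc : ∀ i, IsCompact (K i)) (hK : ∀ i, Convex ℝ (K i)) (hKne : ∀ i, (K i).Nonempty)
    (hcont : ∀ i, ContinuousOn (J i) (Set.univ.pi K))
    (hconv : ∀ i, ∀ x ∈ Set.univ.pi K, ConvexOn ℝ (K i) fun z => J i (Function.update x i z)) :
    ∃ x ∈ Set.univ.pi K, ∀ i, ∀ z ∈ K i, J i x ≤ J i (Function.update x i z) := by
  have hupd : ∀ x ∈ Set.univ.pi K, ∀ i, ∀ z ∈ K i, Function.update x i z ∈ Set.univ.pi K :=
    fun x hx i z hz j _ => by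
      rcases eq_or_ne j i with rfl | hj
      · rwa [Function.update_self]
      · rw [Function.update_of_ne hj]; exact hx j (Set.mem_univ j)
  have hpi : Convex ℝ (Set.univ.pi K) := convex_pi fun i _ => hK i
  obtain ⟨x, hx, hxφ⟩ := exists_forall_le_zero (K := Set.univ.pi K)
    (φ := fun x z => ∑ i, (J i x - J i (Function.update x i (z i))))
    (isCompact_univ_pi hKc) hpi (Set.univ_pi_nonempty_iff.2 hKne)
    (fun z hz => continuousOn_finsetSum _ fun i _ => (hcont i).sub
      ((hcont i).comp (continuous_id.update i continuous_const).continuousOn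
        fun x hx => hupd x hx i _ (hz i (Set.mem_univ i))))
    (fun x hx => by
      have hi : ∀ i, ConcaveOn ℝ (Set.univ.pi K)
          fun z => J i x - J i (Function.update x i (z i)) := fun i =>
        (concaveOn_const _ hpi).sub
          (((hconv i x hx).comp_linearMap (LinearMap.proj i : (ι → V) →ₗ[ℝ] V)).subset
            (fun z hz => hz i (Set.mem_univ i)) hpi)
      refine ⟨hpi, fun y hy z hz a b ha hb hab => ?_⟩
      simp only [Finset.smul_sum, ← Finset.sum_add_distrib]
      exact Finset.sum_le_sum fun i _ => (hi i).2 hy hz ha hb hab)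
    (fun x _ => by simp)
  refine ⟨x, hx, fun i z hz => ?_⟩
  have h := hxφ _ (hupd x hx i z hz)
  rw [Finset.sum_eq_single i (fun j _ hj => by
    rw [Function.update_of_ne hj, Function.update_eq_self, sub_self]) (by simp),
    Function.update_self] at h
  linarith

/-! ### Reduced games -/

/-- The span of the differences of a convex set consists of multiples of differences. -/
lemma Convex.exists_smul_sub_of_mem_vectorSpan {V : Type*} [AddCommGroup V] [Module ℝ V]
    {R : Set V} (hR : Convex ℝ R) (hne : R.Nonempty) {v : V} (hv : v ∈ vectorSpan ℝ R) :
    ∃ t : ℝ, 0 ≤ t ∧ ∃ u ∈ R, ∃ w ∈ R, v = t • (u - w) := by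
  rw [vectorSpan_def] at hv
  induction hv using Submodule.span_induction with
  | mem x hx =>
    obtain ⟨u, hu, w, hw, rfl⟩ := Set.mem_vsub.1 hx
    exact ⟨1, zero_le_one, u, hu, w, hw, by simp⟩
  | zero =>
    obtain ⟨u, hu⟩ := hne
    exact ⟨0, le_rfl, u, hu, u, hu, by simp⟩
  | add x y _ _ hx hy =>
    obtain ⟨s, hs, u, hu, w, hw, rfl⟩ := hx
    obtain ⟨t, ht, u', hu', w', hw', rfl⟩ := hy
    rcases (add_nonneg hs ht).eq_or_lt with h0 | h0
    · have hs0 : s = 0 := by linarith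
      have ht0 : t = 0 := by linarith
      exact ⟨0, le_rfl, u, hu, u, hu, by simp [hs0, ht0]⟩
    · have h1 : s / (s + t) + t / (s + t) = 1 := by rw [← add_div, div_self h0.ne']
      refine ⟨s + t, h0.le, _, hR hu hu' (div_nonneg hs h0.le) (div_nonneg ht h0.le) h1,
        _, hR hw hw' (div_nonneg hs h0.le) (div_nonneg ht h0.le) h1, ?_⟩
      simp only [smul_sub, smul_add, smul_smul, mul_div_cancel₀ _ h0.ne']
      abel
  | smul a x _ hx =>
    obtain ⟨t, ht, u, hu, w, hw, rfl⟩ := hx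
    rcases le_total 0 a with ha | ha
    · exact ⟨a * t, mul_nonneg ha ht, u, hu, w, hw, by rw [mul_smul]⟩
    · refine ⟨-a * t, mul_nonneg (neg_nonneg.2 ha) ht, w, hw, u, hu, ?_⟩
      rw [mul_smul, neg_smul, ← smul_neg, ← smul_neg, neg_sub]

/-- A convex set is closed if a linear map is injective on it and maps it onto a closed set: the
map is then injective on the span of the differences, a closed subspace, which contains the
differences to the limit points. -/
lemma Convex.isClosed_of_injOn {V W : Type*} [NormedAddCommGroup V] [NormedSpace ℝ V]
    [FiniteDimensional ℝ V] [NormedAddCommGroup W] [NormedSpace ℝ W] {f : V →ₗ[ℝ] W} {R : Set V}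
    (hR : Convex ℝ R) (hinj : Set.InjOn f R) (hf : IsClosed (f '' R)) : IsClosed R := by
  have hfc : Continuous f := f.continuous_of_finiteDimensional
  refine isClosed_of_closure_subset fun x hx => ?_
  have hfx : f x ∈ f '' R :=
    hf.closure_subset (image_closure_subset_closure_image hfc ⟨x, hx, rfl⟩)
  obtain ⟨y, hy, hyx⟩ := hfx
  have hspan : x - y ∈ vectorSpan ℝ R := by
    have hclosed : IsClosed ((fun z => z - y) ⁻¹' (vectorSpan ℝ R : Set V)) :=
      (vectorSpan ℝ R).closed_of_finiteDimensional.preimage (by fun_prop)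
    exact closure_minimal (fun z hz => vsub_mem_vectorSpan ℝ hz hy) hclosed hx
  obtain ⟨t, -, u, hu, w, hw, h⟩ := hR.exists_smul_sub_of_mem_vectorSpan ⟨y, hy⟩ hspan
  have h0 : t • (f u - f w) = 0 := by rw [← map_sub, ← map_smul, ← h, map_sub, hyx, sub_self]
  have hxy : x - y = 0 := by
    rcases smul_eq_zero.1 h0 with ht | huw
    · rw [h, ht, zero_smul]
    · rw [h, hinj hu hw (sub_eq_zero.1 huw), sub_self, smul_zero]
  rwa [sub_eq_zero.1 hxy]

namespace StrategicGame

variable {N M K : ℕ} {GB : StrategicGame N M} {GT : StrategicGame N K}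
  {A : Fin N → Matrix (Fin K) (Fin M) ℝ}

/-- Two representatives in `R i` of the same reduced decision give player `i` the same cost, as
does their midpoint, so they coincide by strict convexity. -/
lemma IsContinuousStrictlyConvex.injOn_mulVec (hGB : GB.IsContinuousStrictlyConvex)
    {R : Fin N → Set (Fin M → ℝ)} (hsub : ∀ i, R i ⊆ GB.X i) (hR : ∀ i, Convex ℝ (R i))
    (hne : ∀ i, (R i).Nonempty)
    (hJ : ∀ x ∈ Set.univ.pi R, ∀ i, GT.J i (fun j => (A j).mulVec (x j)) = GB.J i x) (i : Fin N) :
    Set.InjOn (A i).mulVecLin (R i) := by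
  intro u hu v hv huv
  by_contra hne'
  obtain ⟨x, hx⟩ := Set.univ_pi_nonempty_iff.2 hne
  have hval : ∀ w ∈ R i, (A i).mulVec w = (A i).mulVec u →
      GB.J i (Function.update x i w) = GB.J i (Function.update x i u) := by
    intro w hw h
    rw [← hJ _ (Set.update_mem_pi_iff_of_mem hx |>.2 fun _ => hw),
      ← hJ _ (Set.update_mem_pi_iff_of_mem hx |>.2 fun _ => hu)]
    congr 1
    funext j
    rcases eq_or_ne j i with rfl | hj
    · simp [h]
    · simp [hj]
  have huv' : (A i).mulVec u = (A i).mulVec v := huv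
  have h0 : (0 : ℝ) < 1 / 2 := by norm_num
  have h1 : (1 / 2 : ℝ) + 1 / 2 = 1 := by norm_num
  have hlt : GB.J i (Function.update x i ((1 / 2 : ℝ) • u + (1 / 2 : ℝ) • v)) <
      (1 / 2 : ℝ) • GB.J i (Function.update x i u) + (1 / 2 : ℝ) • GB.J i (Function.update x i v) :=
    (hGB.strictConvexOn i x fun j hj => hsub j (hx j hj)).2 (hsub i hu) (hsub i hv) hne' h0 h0 h1
  rw [hval v hv huv'.symm, hval _ (hR i hu hv h0.le h0.le h1) (by
    rw [Matrix.mulVec_add, Matrix.mulVec_smul, Matrix.mulVec_smul, ← huv', ← add_smul, h1,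
      one_smul]), ← add_smul, h1, one_smul] at hlt
  exact lt_irrefl _ hlt

end StrategicGame

theorem proposition2 {N M K : ℕ} (GB : StrategicGame N M) (hGB : GB.IsContinuousStrictlyConvex)
    (A : Fin N → Matrix (Fin K) (Fin M) ℝ) (GT : StrategicGame N K)
    (hGT : StrategicGame.IsReduction GB A GT) :
    ∃ y : Fin N → Fin K → ℝ, GT.IsNashEquilibrium y := by
  obtain ⟨hX, R, hR, hJ⟩ := hGT
  have hsub : ∀ i, R i ⊆ GB.X i := fun i => (hR i).1
  have hpisub : Set.univ.pi R ⊆ GB.profiles := Set.pi_mono fun i _ => hsub i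
  have hne : ∀ i, (R i).Nonempty := fun i => by
    have := GT.X_nonempty i
    rw [← (hR i).2.2] at this
    exact Set.image_nonempty.1 this
  have hcompact : ∀ i, IsCompact (GB.X i) := fun i =>
    Metric.isCompact_of_isClosed_isBounded (hGB.isClosed i) (hGB.isBounded i)
  have hRcompact : ∀ i, IsCompact (R i) := fun i => by
    refine (hcompact i).of_isClosed_subset ?_ (hsub i)
    refine (hR i).2.1.isClosed_of_injOn
      (hGB.injOn_mulVec hsub (fun i => (hR i).2.1) hne hJ i) ?_
    have h1 : (A i).mulVecLin '' R i = (A i).mulVecLin '' GB.X i := (hR i).2.2.trans (hX i)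
    rw [h1]
    exact ((hcompact i).image (A i).mulVecLin.continuous_of_finiteDimensional).isClosed
  obtain ⟨x, hx, hmin⟩ := exists_equilibrium_of_convexOn (J := GB.J) hRcompact
    (fun i => (hR i).2.1) hne (fun i => (hGB.continuousOn i).mono hpisub) fun i x hx =>
      (hGB.strictConvexOn i x (hpisub hx)).convexOn.subset (hsub i) (hR i).2.1
  refine ⟨fun j => (A j).mulVec (x j), fun i _ => ?_, fun i y hy => ?_⟩
  · rw [← (hR i).2.2]
    exact ⟨x i, hx i (Set.mem_univ i), rfl⟩
  · rw [← (hR i).2.2] at hy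
    obtain ⟨z, hz, rfl⟩ := hy
    have hupd : Function.update (fun j => (A j).mulVec (x j)) i ((A i).mulVec z) =
        fun j => (A j).mulVec (Function.update x i z j) := by
      funext j
      rcases eq_or_ne j i with rfl | hj
      · simp
      · simp [hj]
    simp only
    rw [hupd, hJ x hx, hJ _ (Set.update_mem_pi_iff_of_mem hx |>.2 fun _ => hz)]
    exact hmin i z hz
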